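/- Let $G$ be a group (in particular, any finite or locally compact group) and let $V$ be a unitary representation of $G$ on a finite-dimensional Hilbert space $\mathcal V\cong\mathbb C^m$. Write $g(\rho)=V(g)\rho V(g^{-1})$ for $\rho\in\mathrm{End}(\mathcal V)$. Let $\mathcal W\cong\mathcal V$ carry the dual representation $g|w\rangle=V(g^{-1})^T|w\rangle$ (transpose in the fixed orthonormal basis), and let $$(\mathcal V\otimes\mathcal W)^G=\{|x\rangle\in\mathcal V\otimes\mathcal W:\ (V(g)\otimes V(g^{-1})^T)|x\rangle=|x\rangle\ \ \forall g\in G\},\qquad D=\dim(\mathcal V\otimes\mathcal W)^G .$$ Let $\tau_{\mathcal V\mathcal W}=D^{-1}P$, where $P$ is the orthogonal projector onto $(\mathcal V\otimes\mathcal W)^G$, and let $\tau_{\mathcal V}=\mathrm{tr}_{\mathcal W}\,\tau_{\mathcal V\mathcal W}$. (If $\mathcal V=0$, put $\tau_{\mathcal V\mathcal W}=0$.) A purification of an operator $\rho$ on $\mathcal L$ is an operator $|\psi\rangle\langle\psi|$ on $\mathcal L\otimes\mathcal R$, for some finite-dimensional $\mathcal R$, with $\mathrm{tr}_{\mathcal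 R}|\psi\rangle\langle\psi|=\rho$. Let $\|A\|_1=\mathrm{tr}\sqrt{A^\dagger A}$ be the trace norm and $\|\Delta\|_\diamond=\sup_{k\in\mathbb N}\ \sup_{\|\sigma\|_1\le 1}\|(\Delta\otimes\mathsf{id}_k)(\sigma)\|_1$ the diamond norm, where $\mathsf{id}_k$ is the identity map on $\mathrm{End}(\mathbb C^k)$ and $\sigma$ ranges over all operators. Then: 1. For every purification $\tau_{\mathcal V\mathcal W\mathcal N}$ of $\tau_{\mathcal V\mathcal W}$ and every density operator $\rho$ supported on $(\mathcal V\otimes\mathcal W)^G$, there is a completely positive trace-non-increasing map $\mathcal T:\mathrm{End}(\mathcal N)\to\mathbb C$ such that $\rho=D\,(\mathsf{id}\otimes\mathcal T)(\tau_{\mathcal V\mathcal W\mathcal N})$. 2. Let $\mathcal H'$ be a finite-dimensional Hilbert space and $\Delta:\mathrm{End}(\mathcal V)\to\mathrm{End}(\mathcal H')$ a linear map such that for every $g\in G$ there is a completely positive trace-preserving map $\mathcal K_g$ on $\mathrm{End}(\mathcal H')$ with $\Delta\circ g=\mathcal K_g\circ\Delta$. Then, for every purification $\tau_{\mathcal V\mathcal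 R}$ of $\tau_{\mathcal V}$, $$\|\Delta\|_\diamond\ \le\ D\,\bigl\|(\Delta\otimes\mathsf{id})(\tau_{\mathcal V\mathcal R})\bigr\|_1 .$$ -/

import Mathlib

open scoped ComplexOrder Kronecker ENNReal

noncomputable section

namespace PostSelection

/-! A finite-dimensional Hilbert space is `ℂ^m` for a finite index type `m` (a chosen orthonormal
basis), `End(ℂ^m)` is `Matrix m m ℂ`, and `ℂ^m ⊗ ℂ^r` is `ℂ^(m × r)`. -/

/-- The trace norm `‖A‖₁ = tr √(A† A)`. -/
def traceNorm {m : Type*} [Fintype m] [DecidableEq m] (A : Matrix m m ℂ) : ℝ :=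
  (Matrix.trace (cfc Real.sqrt (A.conjTranspose * A))).re

/-- The map `Δ ⊗ id` on `End(ℂ^m ⊗ ℂ^r)`: `Δ` acts on the first factor of every block. -/
def tensorId {m o : Type*} (r : Type*) (Δ : Matrix m m ℂ →ₗ[ℂ] Matrix o o ℂ) :
    Matrix (m × r) (m × r) ℂ →ₗ[ℂ] Matrix (o × r) (o × r) ℂ where
  toFun X := Matrix.of fun p q => Δ (Matrix.of fun i j => X (i, p.2) (j, q.2)) p.1 q.1
  map_add' X Y := by
    ext p q
    exact congrFun (congrFun (Δ.map_add (Matrix.of fun i j => X (i, p.2) (j, q.2))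
      (Matrix.of fun i j => Y (i, p.2) (j, q.2))) p.1) q.1
  map_smul' c X := by
    ext p q
    exact congrFun (congrFun (Δ.map_smul c (Matrix.of fun i j => X (i, p.2) (j, q.2))) p.1) q.1

/-- `(Δ ⊗ id)(A ⊗ B) = Δ(A) ⊗ B`. -/
theorem tensorId_kronecker {m o r : Type*} (Δ : Matrix m m ℂ →ₗ[ℂ] Matrix o o ℂ)
    (A : Matrix m m ℂ) (B : Matrix r r ℂ) : tensorId r Δ (A ⊗ₖ B) = Δ A ⊗ₖ B := by
  ext p q
  have h : (Matrix.of fun i j => (A ⊗ₖ B) (i, p.2) (j, q.2)) = B p.2 q.2 • A := by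
    ext i j
    simp [Matrix.kroneckerMap_apply, mul_comm]
  change Δ (Matrix.of fun i j => (A ⊗ₖ B) (i, p.2) (j, q.2)) p.1 q.1 = _
  rw [h, map_smul, Matrix.smul_apply, Matrix.kroneckerMap_apply, smul_eq_mul, mul_comm]

/-- Complete positivity: `Φ ⊗ id_k` preserves positive operators, for every `k`. -/
def IsCP {m o : Type*} [Fintype m] [Fintype o] (Φ : Matrix m m ℂ →ₗ[ℂ] Matrix o o ℂ) : Prop :=
  ∀ (k : ℕ) (X : Matrix (m × Fin k) (m × Fin k) ℂ),
    X.PosSemidef → (tensorId (Fin k) Φ X).PosSemidef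

/-- Completely positive and trace preserving. -/
def IsCPTP {m o : Type*} [Fintype m] [Fintype o] (Φ : Matrix m m ℂ →ₗ[ℂ] Matrix o o ℂ) : Prop :=
  IsCP Φ ∧ ∀ X, (Φ X).trace = X.trace

/-- The norm `‖F‖₁ = sup {‖F(σ)‖₁ : ‖σ‖₁ ≤ 1}` induced by the trace norm, in `[0, ∞]`. -/
def inducedTraceNorm {m o : Type*} [Fintype m] [DecidableEq m] [Fintype o] [DecidableEq o]
    (F : Matrix m m ℂ →ₗ[ℂ] Matrix o o ℂ) : ℝ≥0∞ :=
  ⨆ (σ : Matrix m m ℂ) (_ : traceNorm σ ≤ 1), ENNReal.ofReal (traceNorm (F σ))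

/-- The diamond norm `‖Δ‖_⋄ = sup_k ‖Δ ⊗ id_k‖₁`, in `[0, ∞]`. -/
def diamondNorm {m o : Type*} [Fintype m] [DecidableEq m] [Fintype o] [DecidableEq o]
    (Δ : Matrix m m ℂ →ₗ[ℂ] Matrix o o ℂ) : ℝ≥0∞ :=
  ⨆ k : ℕ, inducedTraceNorm (tensorId (Fin k) Δ)

/-- The partial trace over the second tensor factor. -/
def partialTrace {m r : Type*} [Fintype r] (X : Matrix (m × r) (m × r) ℂ) : Matrix m m ℂ :=
  Matrix.of fun i j => ∑ a, X (i, a) (j, a)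

/-- `P` is a purification of `ρ` on `ℂ^m ⊗ ℂ^r`: `P = |ψ⟩⟨ψ|` for a vector `ψ`, and `ρ` is the
reduced operator of `P`. -/
def IsPurification {m r : Type*} [Fintype r] (ρ : Matrix m m ℂ)
    (P : Matrix (m × r) (m × r) ℂ) : Prop :=
  (∃ ψ : m × r → ℂ, P = Matrix.vecMulVec ψ (star ψ)) ∧ partialTrace P = ρ

/-- A density operator: positive, of trace one. -/
def IsDensity {m : Type*} [Fintype m] (ρ : Matrix m m ℂ) : Prop :=
  ρ.PosSemidef ∧ ρ.trace = 1

/-- `ρ` is supported on `S`: the range of `ρ` lies in `S`. -/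
def IsSupportedOn {m : Type*} [Fintype m] [DecidableEq m] (ρ : Matrix m m ℂ)
    (S : Submodule ℂ (EuclideanSpace ℂ m)) : Prop :=
  LinearMap.range (Matrix.toEuclideanLin ρ) ≤ S

/-- The map `id ⊗ T` on `End(ℂ^m ⊗ ℂ^r)`, for a functional `T` on `End(ℂ^r)`. -/
def idTensor {m r : Type*} (T : Matrix r r ℂ →ₗ[ℂ] ℂ) (X : Matrix (m × r) (m × r) ℂ) :
    Matrix m m ℂ :=
  Matrix.of fun i j => T (Matrix.of fun a b => X (i, a) (j, b))

/-- `T : End(ℂ^r) → ℂ` is completely positive and does not increase the trace of positive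
operators. -/
def IsCPTraceNonincreasing {r : Type*} [Fintype r] (T : Matrix r r ℂ →ₗ[ℂ] ℂ) : Prop :=
  (∀ (k : ℕ) (X : Matrix (Fin k × r) (Fin k × r) ℂ), X.PosSemidef → (idTensor T X).PosSemidef) ∧
    ∀ X : Matrix r r ℂ, X.PosSemidef → T X ≤ X.trace

section Representation

variable {G ι : Type*} [Group G] [Fintype ι] [DecidableEq ι]

/-- The action `ρ ↦ V(g) ρ V(g⁻¹)` of `g` on `End(V)`. -/
def conjAction (V : G →* Matrix.unitaryGroup ι ℂ) (g : G) :
    Matrix ι ι ℂ →ₗ[ℂ] Matrix ι ι ℂ :=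
  LinearMap.mulLeftRight ℂ ((V g : Matrix ι ι ℂ), (V g⁻¹ : Matrix ι ι ℂ))

/-- The dual action `V(g⁻¹)ᵀ` of `g` on the space `W ≅ V`. -/
def dualAction (V : G →* Matrix.unitaryGroup ι ℂ) (g : G) : Matrix ι ι ℂ :=
  (V g⁻¹ : Matrix ι ι ℂ).transpose

/-- The invariant space `(V ⊗ W)^G`, where `g` acts by `V(g) ⊗ V(g⁻¹)ᵀ`. -/
def invariantSpace (V : G →* Matrix.unitaryGroup ι ℂ) :
    Submodule ℂ (EuclideanSpace ℂ (ι × ι)) :=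
  ⨅ g : G, LinearMap.eqLocus
    (Matrix.toEuclideanLin ((V g : Matrix ι ι ℂ) ⊗ₖ dualAction V g)) LinearMap.id

/-- The dimension of `(V ⊗ W)^G`. -/
def invariantDim (V : G →* Matrix.unitaryGroup ι ℂ) : ℕ :=
  Module.finrank ℂ (invariantSpace V)

/-- The state `τ_{VW}`: the orthogonal projector onto `(V ⊗ W)^G`, divided by its trace
`dim (V ⊗ W)^G`. -/
def tauVW (V : G →* Matrix.unitaryGroup ι ℂ) : Matrix (ι × ι) (ι × ι) ℂ :=
  (invariantDim V : ℂ)⁻¹ •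
    Matrix.toEuclideanLin.symm ((invariantSpace V).starProjection).toLinearMap

/-- The state `τ_V = tr_W τ_{VW}`. -/
def tauV (V : G →* Matrix.unitaryGroup ι ℂ) : Matrix ι ι ℂ :=
  partialTrace (tauVW V)

end Representation

end PostSelection

end

/-! Vectorization identifies the invariant vectors with the commutant of `V`. If `x ≥ 0` lies in the
commutant and has trace at most one, the vector of `√x` is invariant of norm at most one, so its
rank-one operator lies below the invariant projector; tracing out the dual factor gives `x ≤ D τ_V`
(`posSemidef_partialTrace_invariantProjector_sub`).

The diamond bound needs no Hermiticity because the trace norm is the least value of `(‖C‖² + ‖D‖²) /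
2` (Hilbert–Schmidt) over factorizations `C Dᴴ`. A balanced factorization of `σ` gives two reduced
operators `x_b`. Reaching `g(σ)` from the purification by operators on the `R` side, together with a
balanced factorization of `(Δ ⊗ id)(τ)`, bounds `‖(Δ ⊗ id)(g(σ))‖₁` by a real-linear functional `F`
of the rotated `x_b`. Covariance makes this a bound on `‖(Δ ⊗ id)(σ)‖₁` for every `g`. A least-norm
argument replaces averaging over `G` (`exists_commute_of_forall_orbit_le`), so the `x_b` may be
replaced by commutant elements, which are at most `D τ_V`; there `F` is at most `D ‖(Δ ⊗ id)(τ)‖₁`.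

The extraction statement is direct: steering the purification by the effect `D ψᴴ ρ ψ`, transposed,
produces `P ρ P = ρ`. -/

namespace PostSelection

open Matrix

/-! ### Trace norm via polar decomposition and factorizations -/

section TraceNorm

variable {m n p : Type*} [Fintype m] [Fintype n] [Fintype p]

/-- The squared Hilbert–Schmidt norm `tr (M M†)`. -/
noncomputable def sqNorm (M : Matrix m n ℂ) : ℝ := (M * Mᴴ).trace.re

theorem sqNorm_eq_sum (M : Matrix m n ℂ) : sqNorm M = ∑ i, ∑ j, ‖M i j‖ ^ 2 := by
  simp [sqNorm, Matrix.trace, Matrix.mul_apply, Complex.mul_conj, Complex.normSq_eq_norm_sq,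
    -Complex.ofReal_pow]

theorem sqNorm_nonneg (M : Matrix m n ℂ) : 0 ≤ sqNorm M := by
  rw [sqNorm_eq_sum]; positivity

theorem sqNorm_conjTranspose_eq (M : Matrix m n ℂ) : sqNorm M = (Mᴴ * M).trace.re := by
  rw [sqNorm, trace_mul_comm]

theorem re_trace_mul_conjTranspose_le (C D : Matrix m n ℂ) :
    (C * Dᴴ).trace.re ≤ (sqNorm C + sqNorm D) / 2 := by
  have h := sqNorm_nonneg (C - D)
  have h1 : (D * Cᴴ).trace.re = (C * Dᴴ).trace.re := by
    have : D * Cᴴ = (C * Dᴴ)ᴴ := by simp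
    rw [this, trace_conjTranspose]; simp
  have h2 : sqNorm (C - D) = sqNorm C + sqNorm D - 2 * (C * Dᴴ).trace.re := by
    simp only [sqNorm, conjTranspose_sub, Matrix.sub_mul, Matrix.mul_sub, trace_sub, Complex.sub_re,
      h1]
    ring
  linarith

/-- A projection does not increase the Hilbert–Schmidt norm. -/
theorem re_trace_conjTranspose_mul_mul_le {Q : Matrix m m ℂ} (hQ : Qᴴ = Q) (hQQ : Q * Q = Q)
    (C : Matrix m n ℂ) : (Cᴴ * Q * C).trace.re ≤ sqNorm C := by
  have h := sqNorm_nonneg (C - Q * C)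
  have h2 : sqNorm (C - Q * C) = sqNorm C - (Cᴴ * Q * C).trace.re := by
    rw [sqNorm_conjTranspose_eq, sqNorm_conjTranspose_eq, ← Complex.sub_re, ← trace_sub]
    congr 2
    simp only [conjTranspose_sub, conjTranspose_mul, hQ, Matrix.sub_mul, Matrix.mul_sub,
      Matrix.mul_assoc]
    rw [← Matrix.mul_assoc Q Q C, hQQ]
    simp
  linarith

variable [DecidableEq m]

/-- A finite spectrum makes every function admissible for the calculus, including `(√x)⁻¹`, whose
value `0` at `0` yields a pseudo-inverse. -/
theorem continuousOn_real_spectrum (A : Matrix m m ℂ) (f : ℝ → ℝ) :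
    ContinuousOn f (spectrum ℝ A) :=
  Matrix.finite_real_spectrum.continuousOn f

theorem cfc_mul_cfc (f g : ℝ → ℝ) (A : Matrix m m ℂ) :
    cfc f A * cfc g A = cfc (fun x => f x * g x) A :=
  (cfc_mul f g A (continuousOn_real_spectrum A f) (continuousOn_real_spectrum A g)).symm

theorem spectrum_real_nonneg {A : Matrix m m ℂ} (hA : A.PosSemidef) :
    ∀ x ∈ spectrum ℝ A, 0 ≤ x := by
  intro x hx
  obtain ⟨i, rfl⟩ := hA.1.spectrum_real_eq_range_eigenvalues ▸ hx
  exact hA.eigenvalues_nonneg i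

theorem spectrum_conjTranspose_mul_self_nonneg (A : Matrix m m ℂ) :
    ∀ x ∈ spectrum ℝ (Aᴴ * A), 0 ≤ x :=
  spectrum_real_nonneg (posSemidef_conjTranspose_mul_self A)

theorem cfc_conjTranspose (f : ℝ → ℝ) (A : Matrix m m ℂ) : (cfc f A)ᴴ = cfc f A :=
  (cfc_predicate f A : IsSelfAdjoint (cfc f A))

/-- The pseudo-inverse of `√(A† A)`. -/
noncomputable def absPinv (A : Matrix m m ℂ) : Matrix m m ℂ :=
  cfc (fun x : ℝ => (Real.sqrt x)⁻¹) (Aᴴ * A)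

omit [DecidableEq m] in
theorem isSelfAdjoint_conjTranspose_mul (A : Matrix m m ℂ) : IsSelfAdjoint (Aᴴ * A) :=
  isHermitian_conjTranspose_mul_self A

theorem absPinv_mul (A : Matrix m m ℂ) :
    absPinv A * (Aᴴ * A) = cfc Real.sqrt (Aᴴ * A) := by
  have h := isSelfAdjoint_conjTranspose_mul A
  conv_lhs => rw [← cfc_id' ℝ (Aᴴ * A) h, absPinv, cfc_mul_cfc]
  refine cfc_congr fun x hx => ?_
  have hx := spectrum_conjTranspose_mul_self_nonneg A x hx
  rcases hx.eq_or_lt with rfl | h0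
  · simp
  · have : Real.sqrt x ≠ 0 := (Real.sqrt_pos.2 h0).ne'
    field_simp
    exact (Real.sq_sqrt hx).symm

/-- With `U = A * absPinv A`, the partial isometry of the polar decomposition, the matrix is the
range projector `U Uᴴ`. -/
theorem mul_absPinv_mul_self_projection (A : Matrix m m ℂ) :
    (A * absPinv A * absPinv A * Aᴴ) * (A * absPinv A * absPinv A * Aᴴ) =
      A * absPinv A * absPinv A * Aᴴ := by
  have h1 : absPinv A * (Aᴴ * A) * absPinv A * absPinv A = absPinv A := by
    rw [absPinv_mul, absPinv, cfc_mul_cfc, cfc_mul_cfc]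
    refine cfc_congr fun x hx => ?_
    have hx := spectrum_conjTranspose_mul_self_nonneg A x hx
    rcases hx.eq_or_lt with rfl | h0
    · simp
    · have : Real.sqrt x ≠ 0 := (Real.sqrt_pos.2 h0).ne'
      field_simp
  calc _ = A * absPinv A * (absPinv A * (Aᴴ * A) * absPinv A * absPinv A) * Aᴴ := by
        simp only [Matrix.mul_assoc]
    _ = _ := by rw [h1]

/-- Every factorization bounds the trace norm. -/
theorem traceNorm_mul_conjTranspose_le (C D : Matrix m n ℂ) :
    traceNorm (C * Dᴴ) ≤ (sqNorm C + sqNorm D) / 2 := by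
  set A := C * Dᴴ with hA
  -- `tr |A| = tr (Uᴴ C Dᴴ)` for the polar isometry `U`; since `Uᴴ` is a contraction, the
  -- arithmetic–geometric bound for `Uᴴ C` and `D` suffices.
  have h1 : traceNorm A = ((absPinv A * Aᴴ * C) * Dᴴ).trace.re := by
    rw [traceNorm, ← absPinv_mul, Matrix.mul_assoc _ C, ← hA, Matrix.mul_assoc]
  have h2 : sqNorm (absPinv A * Aᴴ * C) ≤ sqNorm C := by
    have hs : (absPinv A)ᴴ = absPinv A := cfc_conjTranspose _ _
    have := re_trace_conjTranspose_mul_mul_le (Q := A * absPinv A * absPinv A * Aᴴ)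
      (by simp [hs, Matrix.mul_assoc]) (mul_absPinv_mul_self_projection A) C
    rw [sqNorm_conjTranspose_eq]
    simpa [hs, Matrix.mul_assoc] using this
  rw [h1]
  linarith [re_trace_mul_conjTranspose_le (absPinv A * Aᴴ * C) D]

/-- The trace norm is attained by a balanced factorization. -/
theorem exists_traceNorm_factorization (A : Matrix m m ℂ) :
    ∃ L R : Matrix m m ℂ, A = L * Rᴴ ∧ sqNorm L = traceNorm A ∧ sqNorm R = traceNorm A := by
  set h := cfc (fun x : ℝ => Real.sqrt (Real.sqrt x)) (Aᴴ * A) with hh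
  have hs : (absPinv A)ᴴ = absPinv A := cfc_conjTranspose _ _
  have hhs : hᴴ = h := cfc_conjTranspose _ _
  have h4 : h * h = cfc Real.sqrt (Aᴴ * A) := by
    rw [hh, cfc_mul_cfc]
    exact cfc_congr fun x _ => Real.mul_self_sqrt (Real.sqrt_nonneg x)
  -- Split `A = U |A|` as `(U |A|^{1/2}) (|A|^{1/2})ᴴ`.
  refine ⟨A * absPinv A * h, h, ?_, ?_, ?_⟩
  · rw [hhs, Matrix.mul_assoc, h4]
    have hP : absPinv A * cfc Real.sqrt (Aᴴ * A) =
        cfc (fun x : ℝ => (Real.sqrt x)⁻¹ * Real.sqrt x) (Aᴴ * A) := by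
      rw [absPinv, cfc_mul_cfc]
    -- What remains is `A = A e` with `e` the support projection of `|A|`, obtained from `(A - A e)ᴴ
    -- (A - A e) = 0`.
    rw [Matrix.mul_assoc, hP, ← sub_eq_zero, ← conjTranspose_mul_self_eq_zero]
    set e := cfc (fun x : ℝ => (Real.sqrt x)⁻¹ * Real.sqrt x) (Aᴴ * A) with he
    have hes : eᴴ = e := cfc_conjTranspose _ _
    have h5 : (Aᴴ * A) * e = Aᴴ * A := by
      have hsa := isSelfAdjoint_conjTranspose_mul A
      conv_lhs => rw [he]; enter [1]; rw [← cfc_id' ℝ (Aᴴ * A) hsa]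
      conv_rhs => rw [← cfc_id' ℝ (Aᴴ * A) hsa]
      rw [cfc_mul_cfc]
      refine cfc_congr fun x hx => ?_
      have hx := spectrum_conjTranspose_mul_self_nonneg A x hx
      rcases hx.eq_or_lt with rfl | h0
      · simp
      · have : Real.sqrt x ≠ 0 := (Real.sqrt_pos.2 h0).ne'
        field_simp
    simp only [conjTranspose_sub, conjTranspose_mul, hes, Matrix.sub_mul, Matrix.mul_sub]
    have h6 : e * Aᴴ * (A * e) = e * Aᴴ * A := by
      rw [Matrix.mul_assoc e, ← Matrix.mul_assoc Aᴴ, h5, ← Matrix.mul_assoc]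
    rw [h6, ← Matrix.mul_assoc Aᴴ, h5]
    simp
  · rw [sqNorm_conjTranspose_eq, traceNorm]
    congr 2
    have : (A * absPinv A * h)ᴴ * (A * absPinv A * h) =
        h * (absPinv A * (Aᴴ * A)) * absPinv A * h := by
      simp [hs, hhs, Matrix.mul_assoc]
    rw [this, absPinv_mul, absPinv, hh, cfc_mul_cfc, cfc_mul_cfc, cfc_mul_cfc]
    refine cfc_congr fun x hx => ?_
    have hx := spectrum_conjTranspose_mul_self_nonneg A x hx
    rcases hx.eq_or_lt with rfl | h0
    · simp
    · have : Real.sqrt x ≠ 0 := (Real.sqrt_pos.2 h0).ne'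
      have h7 := Real.mul_self_sqrt (Real.sqrt_nonneg x)
      field_simp
      rw [sq, h7]
  · rw [sqNorm, hhs, h4, traceNorm]

/-- Every positive matrix is a square `B B†`. -/
theorem exists_eq_mul_conjTranspose {A : Matrix m m ℂ} (hA : A.PosSemidef) :
    ∃ B : Matrix m m ℂ, A = B * Bᴴ ∧ Bᴴ = B ∧ ∀ C, Commute A C → Commute B C := by
  refine ⟨cfc Real.sqrt A, ?_, cfc_conjTranspose _ _, fun C h => h.cfc_real _⟩
  have hsa : IsSelfAdjoint A := hA.1
  conv_lhs => rw [← cfc_id' ℝ A hsa]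
  rw [cfc_conjTranspose, cfc_mul_cfc]
  exact cfc_congr fun x hx => (Real.mul_self_sqrt
    (spectrum_real_nonneg hA x hx)).symm

theorem trace_mul_nonneg {A B : Matrix m m ℂ} (hA : A.PosSemidef) (hB : B.PosSemidef) :
    0 ≤ (A * B).trace := by
  obtain ⟨C, rfl, -, -⟩ := exists_eq_mul_conjTranspose hB
  rw [← Matrix.mul_assoc, trace_mul_comm, ← Matrix.mul_assoc]
  exact (hA.conjTranspose_mul_mul_same C).trace_nonneg

end TraceNorm

/-! ### Completely positive maps and the trace norm -/

section CompletelyPositive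

variable {m o r : Type*} [Fintype m] [Fintype o] [Fintype r]

theorem IsCP.posSemidef_tensorId {Φ : Matrix m m ℂ →ₗ[ℂ] Matrix o o ℂ} (hΦ : IsCP Φ)
    {X : Matrix (m × r) (m × r) ℂ} (hX : X.PosSemidef) : (tensorId r Φ X).PosSemidef := by
  let e := Fintype.equivFin r
  have h := hΦ _ (X.submatrix (Prod.map id e.symm) (Prod.map id e.symm)) (hX.submatrix _)
  have h2 := h.submatrix (Prod.map id e : o × r → o × _)
  have : (tensorId (Fin (Fintype.card r)) Φ
      (X.submatrix (Prod.map id e.symm) (Prod.map id e.symm))).submatrix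
        (Prod.map id e) (Prod.map id e) = tensorId r Φ X := by
    ext ⟨p, a⟩ ⟨q, b⟩
    simp [tensorId]
  rwa [this] at h2

theorem trace_tensorId {Φ : Matrix m m ℂ →ₗ[ℂ] Matrix o o ℂ}
    (hΦ : ∀ X, (Φ X).trace = X.trace) (X : Matrix (m × r) (m × r) ℂ) :
    (tensorId r Φ X).trace = X.trace := by
  have h : ∀ a, ∑ p, Φ (Matrix.of fun i j => X (i, a) (j, a)) p p = ∑ i, X (i, a) (i, a) :=
    fun a => hΦ (Matrix.of fun i j => X (i, a) (j, a))
  calc (tensorId r Φ X).trace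
      = ∑ a, ∑ p, Φ (Matrix.of fun i j => X (i, a) (j, a)) p p := Fintype.sum_prod_type_right _
    _ = ∑ a, ∑ i, X (i, a) (i, a) := Finset.sum_congr rfl fun a _ => h a
    _ = X.trace := by rw [Matrix.trace, Fintype.sum_prod_type_right]; rfl

/-- A completely positive trace preserving map, tensored with an identity map, does not increase
the trace norm of any operator. -/
theorem IsCPTP.traceNorm_tensorId_le [DecidableEq m] [DecidableEq o] [DecidableEq r]
    {Φ : Matrix m m ℂ →ₗ[ℂ] Matrix o o ℂ} (hΦ : IsCPTP Φ) (X : Matrix (m × r) (m × r) ℂ) :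
    traceNorm (tensorId r Φ X) ≤ traceNorm X := by
  obtain ⟨L, R, hX, hL, hR⟩ := exists_traceNorm_factorization X
  -- Stacking `L` over `R` makes `B Bᴴ` a positive block operator with off-diagonal block `L Rᴴ =
  -- X`. Its image is again positive, and a square root of that image factors the image of `X`, with
  -- norms fixed by trace preservation on the diagonal blocks.
  let B : Matrix (m × (r × Bool)) (m × r) ℂ :=
    Matrix.of fun p q => bif p.2.2 then L (p.1, p.2.1) q else R (p.1, p.2.1) q
  have hW := hΦ.1.posSemidef_tensorId (posSemidef_self_mul_conjTranspose B)
  obtain ⟨E, hE, -, -⟩ := exists_eq_mul_conjTranspose hW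
  let C : Matrix (o × r) (o × (r × Bool)) ℂ := Matrix.of fun p q => E (p.1, (p.2, true)) q
  let D : Matrix (o × r) (o × (r × Bool)) ℂ := Matrix.of fun p q => E (p.1, (p.2, false)) q
  have key : ∀ s t : Bool, ∀ p q : o × r,
      tensorId (r × Bool) Φ (B * Bᴴ) (p.1, (p.2, s)) (q.1, (q.2, t)) =
        tensorId r Φ ((bif s then L else R) * (bif t then L else R)ᴴ) p q := by
    intro s t p q
    simp only [tensorId, LinearMap.coe_mk, AddHom.coe_mk, of_apply]
    refine congrArg (fun Y => Φ Y p.1 q.1) ?_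
    ext i j
    cases s <;> cases t <;> rfl
  have hCD : C * Dᴴ = tensorId r Φ X := by
    ext p q
    have := key true false p q
    rw [hE] at this
    rw [hX]
    exact this
  have hCC : C * Cᴴ = tensorId r Φ (L * Lᴴ) := by
    ext p q
    have := key true true p q
    rw [hE] at this
    exact this
  have hDD : D * Dᴴ = tensorId r Φ (R * Rᴴ) := by
    ext p q
    have := key false false p q
    rw [hE] at this
    exact this
  have hC : sqNorm C = traceNorm X := by
    rw [sqNorm, hCC, trace_tensorId hΦ.2, ← hL, sqNorm]
  have hD : sqNorm D = traceNorm X := by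
    rw [sqNorm, hDD, trace_tensorId hΦ.2, ← hR, sqNorm]
  have := traceNorm_mul_conjTranspose_le C D
  rw [hCD, hC, hD] at this
  linarith

end CompletelyPositive

/-! ### Positivity and partial traces -/

section PositiveMatrices

variable {m n r : Type*} [Fintype m] [Fintype n] [Fintype r]

/-- Nonnegative eigenvalues with sum at most one are each at most one. -/
theorem posSemidef_one_sub [DecidableEq m] {ρ : Matrix m m ℂ} (hρ : ρ.PosSemidef)
    (ht : ρ.trace.re ≤ 1) : (1 - ρ).PosSemidef := by
  have hev : ∀ i, hρ.1.eigenvalues i ≤ 1 := by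
    intro i
    have h1 : ∑ j, hρ.1.eigenvalues j = ρ.trace.re := by
      rw [hρ.1.trace_eq_sum_eigenvalues]; simp
    have := Finset.single_le_sum (f := hρ.1.eigenvalues)
      (fun j _ => hρ.eigenvalues_nonneg j) (Finset.mem_univ i)
    linarith
  set U : Matrix m m ℂ := (hρ.1.eigenvectorUnitary : Matrix m m ℂ) with hU
  have hUU : U * Uᴴ = 1 := Unitary.coe_mul_star_self _
  have h2 : ρ = U * diagonal (RCLike.ofReal ∘ hρ.1.eigenvalues) * Uᴴ := by
    conv_lhs => rw [hρ.1.spectral_theorem, Unitary.conjStarAlgAut_apply]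
    rfl
  have h3 : (diagonal (fun i => (1 : ℂ) - (hρ.1.eigenvalues i : ℂ))).PosSemidef := by
    apply PosSemidef.diagonal
    intro i
    have : (0 : ℝ) ≤ 1 - hρ.1.eigenvalues i := sub_nonneg.2 (hev i)
    simpa using (by exact_mod_cast this : (0 : ℂ) ≤ ((1 - hρ.1.eigenvalues i : ℝ) : ℂ))
  have h4 : 1 - ρ = U * diagonal (fun i => (1 : ℂ) - (hρ.1.eigenvalues i : ℂ)) * Uᴴ := by
    rw [← diagonal_sub, diagonal_one, Matrix.mul_sub, Matrix.sub_mul, Matrix.mul_one, hUU]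
    congr 1
  rw [h4]
  exact h3.mul_mul_conjTranspose_same U

omit [Fintype m] in
theorem partialTrace_sub (X Y : Matrix (m × r) (m × r) ℂ) :
    partialTrace (X - Y) = partialTrace X - partialTrace Y := by
  ext i j; simp [partialTrace]

omit [Fintype m] in
theorem partialTrace_smul (c : ℂ) (X : Matrix (m × r) (m × r) ℂ) :
    partialTrace (c • X) = c • partialTrace X := by
  ext i j; simp [partialTrace, Finset.mul_sum]

omit [Fintype m] in
theorem posSemidef_partialTrace {X : Matrix (m × r) (m × r) ℂ} (hX : X.PosSemidef) :
    (partialTrace X).PosSemidef := by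
  have : partialTrace X = ∑ a, X.submatrix (fun i => (i, a)) (fun i => (i, a)) := by
    ext i j; simp [partialTrace, Matrix.sum_apply]
  rw [this]
  exact posSemidef_sum _ fun a _ => hX.submatrix _

/-- The matrix of a vector of a tensor product. -/
def unvec (ψ : m × r → ℂ) : Matrix m r ℂ := Matrix.of fun i a => ψ (i, a)

omit [Fintype m] in
theorem partialTrace_vecMulVec (ψ : m × r → ℂ) :
    partialTrace (vecMulVec ψ (star ψ)) = unvec ψ * (unvec ψ)ᴴ := by
  ext i j
  simp [partialTrace, unvec, Matrix.mul_apply, vecMulVec_apply]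

end PositiveMatrices

/-! ### The invariant projector dominates the commutant -/

section InvariantProjector

variable {G ι : Type*} [Group G] [Fintype ι] [DecidableEq ι]

/-- The matrix of the orthogonal projector onto `(V ⊗ W)^G`. -/
noncomputable def invariantProjector (V : G →* Matrix.unitaryGroup ι ℂ) :
    Matrix (ι × ι) (ι × ι) ℂ :=
  Matrix.toEuclideanLin.symm ((invariantSpace V).starProjection).toLinearMap

theorem toEuclideanLin_invariantProjector (V : G →* Matrix.unitaryGroup ι ℂ) :
    Matrix.toEuclideanLin (invariantProjector V) =
      ((invariantSpace V).starProjection).toLinearMap :=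
  LinearEquiv.apply_symm_apply _ _

theorem invariantProjector_conjTranspose (V : G →* Matrix.unitaryGroup ι ℂ) :
    (invariantProjector V)ᴴ = invariantProjector V := by
  have : (invariantProjector V).IsHermitian := by
    rw [← isSymmetric_toEuclideanLin_iff, toEuclideanLin_invariantProjector]
    exact Submodule.starProjection_isSymmetric _
  exact this

theorem invariantProjector_mulVec {V : G →* Matrix.unitaryGroup ι ℂ}
    {x : EuclideanSpace ℂ (ι × ι)} (hx : x ∈ invariantSpace V) :
    invariantProjector V *ᵥ x.ofLp = x.ofLp := by
  have h : Matrix.toEuclideanLin (invariantProjector V) x = x := by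
    rw [toEuclideanLin_invariantProjector]
    exact Submodule.starProjection_eq_self_iff.2 hx
  exact congrArg WithLp.ofLp h

theorem invariantProjector_mul_of_range_le {V : G →* Matrix.unitaryGroup ι ℂ}
    {ρ : Matrix (ι × ι) (ι × ι) ℂ}
    (h : LinearMap.range (Matrix.toEuclideanLin ρ) ≤ invariantSpace V) :
    invariantProjector V * ρ = ρ := by
  apply Matrix.toEuclideanLin.injective
  rw [toLpLin_mul_same, toEuclideanLin_invariantProjector]
  ext1 x
  exact Submodule.starProjection_eq_self_iff.2 (h ⟨x, rfl⟩)

theorem invariantProjector_mul_self (V : G →* Matrix.unitaryGroup ι ℂ) :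
    invariantProjector V * invariantProjector V = invariantProjector V := by
  apply invariantProjector_mul_of_range_le
  rw [toEuclideanLin_invariantProjector]
  rintro _ ⟨x, rfl⟩
  exact Submodule.starProjection_apply_mem _ x

theorem invariantDim_smul_tauVW (V : G →* Matrix.unitaryGroup ι ℂ) :
    (invariantDim V : ℂ) • tauVW V = invariantProjector V := by
  rw [tauVW]
  change (invariantDim V : ℂ) • (invariantDim V : ℂ)⁻¹ • invariantProjector V = _
  -- For `D = 0` the convention `0⁻¹ = 0` is harmless, since the projector itself vanishes.
  by_cases h : invariantDim V = 0
  · have h0 : invariantSpace V = ⊥ := Submodule.finrank_eq_zero.1 h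
    have : invariantProjector V = 0 := by
      simp [invariantProjector, h0]
    simp [this]
  · rw [smul_smul, mul_inv_cancel₀ (Nat.cast_ne_zero.2 h), one_smul]

/-- On the vectorization of `y`, the tensor action is conjugation `y ↦ V(g) y V(g⁻¹)`. -/
theorem mem_invariantSpace_of_commute {V : G →* Matrix.unitaryGroup ι ℂ} {y : Matrix ι ι ℂ}
    (hy : ∀ g, Commute y (V g : Matrix ι ι ℂ)) :
    WithLp.toLp 2 (fun p : ι × ι => y p.1 p.2) ∈ invariantSpace V := by
  simp only [invariantSpace, Submodule.mem_iInf, LinearMap.mem_eqLocus, LinearMap.id_apply]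
  intro g
  rw [toLpLin_toLp, toLin'_apply]
  congr 1
  have h1 : (V g : Matrix ι ι ℂ) * y * (V g⁻¹ : Matrix ι ι ℂ) = y := by
    rw [← (hy g).eq, Matrix.mul_assoc]
    have : (V g : Matrix ι ι ℂ) * (V g⁻¹ : Matrix ι ι ℂ) = 1 := by
      rw [← UnitaryGroup.mul_val, ← map_mul]; simp
    rw [this, Matrix.mul_one]
  ext ⟨i, j⟩
  conv_rhs => rw [← h1]
  simp only [mulVec, dotProduct, kroneckerMap_apply, dualAction, transpose_apply, Matrix.mul_apply,
    Fintype.sum_prod_type, Finset.sum_mul]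
  rw [Finset.sum_comm]
  refine Finset.sum_congr rfl fun k _ => Finset.sum_congr rfl fun l _ => by ring

/-- A positive operator of trace at most one that commutes with the representation is dominated by
`D τ_V`. -/
theorem posSemidef_partialTrace_invariantProjector_sub {V : G →* Matrix.unitaryGroup ι ℂ}
    {x : Matrix ι ι ℂ} (hx : x.PosSemidef) (hxt : x.trace.re ≤ 1)
    (hxc : ∀ g, Commute x (V g : Matrix ι ι ℂ)) :
    (partialTrace (invariantProjector V) - x).PosSemidef := by
  obtain ⟨y, hxy, hy, hyc⟩ := exists_eq_mul_conjTranspose hx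
  let v : ι × ι → ℂ := fun p => y p.1 p.2
  have hv : invariantProjector V *ᵥ v = v :=
    invariantProjector_mulVec (mem_invariantSpace_of_commute fun g => hyc _ (hxc g))
  have h1 : partialTrace (vecMulVec v (star v)) = x := by
    rw [partialTrace_vecMulVec, hxy]; rfl
  have h2 : (1 - vecMulVec v (star v)).PosSemidef := by
    refine posSemidef_one_sub (posSemidef_vecMulVec_self_star v) ?_
    have : (vecMulVec v (star v)).trace = x.trace := by
      rw [← h1]
      exact Fintype.sum_prod_type _
    rwa [this]
  -- As `v` is invariant, compressing `1 - |v⟩⟨v| ≥ 0` by the projector changes only the identity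
  -- term.
  have h3 : invariantProjector V - vecMulVec v (star v) =
      invariantProjector V * (1 - vecMulVec v (star v)) * (invariantProjector V)ᴴ := by
    have h4 : vecMulVec v (star v) * invariantProjector V = vecMulVec v (star v) := by
      have h5 : invariantProjector V * vecMulVec v (star v) = vecMulVec v (star v) := by
        rw [mul_vecMulVec, hv]
      have := congrArg conjTranspose h5
      rwa [conjTranspose_mul, invariantProjector_conjTranspose,
        (posSemidef_vecMulVec_self_star v).1.eq] at this
    rw [invariantProjector_conjTranspose, Matrix.mul_sub, Matrix.mul_one, Matrix.sub_mul,
      invariantProjector_mul_self, Matrix.mul_assoc, h4, mul_vecMulVec, hv]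
  rw [← h1, ← partialTrace_sub, h3]
  exact posSemidef_partialTrace (h2.mul_mul_conjTranspose_same _)

/-- The maximally mixed state commutes with everything, so the partial trace dominates a positive
definite matrix. -/
theorem isUnit_partialTrace_invariantProjector (V : G →* Matrix.unitaryGroup ι ℂ) :
    IsUnit (partialTrace (invariantProjector V)) := by
  rcases isEmpty_or_nonempty ι with hι | hι
  · exact isUnit_of_subsingleton _
  have hc : (0 : ℝ) < (Fintype.card ι : ℝ)⁻¹ := by positivity
  have hc' : (0 : ℂ) < (Fintype.card ι : ℂ)⁻¹ := by
    have := Complex.zero_lt_real.2 hc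
    rwa [Complex.ofReal_inv, Complex.ofReal_natCast] at this
  have h1 : ((Fintype.card ι : ℂ)⁻¹ • (1 : Matrix ι ι ℂ)).PosDef := PosDef.one.smul hc'
  have h2 := posSemidef_partialTrace_invariantProjector_sub (V := V) h1.posSemidef
    (by rw [trace_smul, trace_one, smul_eq_mul, inv_mul_cancel₀]
        · simp
        · exact Nat.cast_ne_zero.2 Fintype.card_ne_zero)
    (fun g => (Commute.one_left _).smul_left _)
  have := h1.add_posSemidef h2
  rw [add_sub_cancel] at this
  exact this.isUnit

end InvariantProjector

/-! ### Extraction by post-selection -/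

section Extraction

variable {r : Type*} [Fintype r]

/-- The functional `X ↦ tr (X W)`. -/
def traceFunctional (W : Matrix r r ℂ) : Matrix r r ℂ →ₗ[ℂ] ℂ :=
  Matrix.traceLinearMap r ℂ ℂ ∘ₗ LinearMap.mulRight ℂ W

theorem traceFunctional_apply (W X : Matrix r r ℂ) : traceFunctional W X = (X * W).trace := rfl

/-- Writing `W = B Bᴴ`, the extended functional is compression by `1 ⊗ B` followed by a partial
trace; the trace bound is `tr (X (1 - W)) ≥ 0`. -/
theorem isCPTraceNonincreasing_traceFunctional [DecidableEq r] {W : Matrix r r ℂ}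
    (hW : W.PosSemidef) (hW1 : (1 - W).PosSemidef) :
    IsCPTraceNonincreasing (traceFunctional W) := by
  constructor
  · intro k X hX
    obtain ⟨B, hB, -, -⟩ := exists_eq_mul_conjTranspose hW
    have h := posSemidef_partialTrace
      (hX.conjTranspose_mul_mul_same ((1 : Matrix (Fin k) (Fin k) ℂ) ⊗ₖ B))
    have h2 : partialTrace (((1 : Matrix (Fin k) (Fin k) ℂ) ⊗ₖ B)ᴴ * X * (1 ⊗ₖ B)) =
        idTensor (traceFunctional W) X := by
      ext i j
      have h3 : idTensor (traceFunctional W) X i j =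
          (Bᴴ * (Matrix.of fun a b => X (i, a) (j, b)) * B).trace := by
        rw [Matrix.mul_assoc, trace_mul_comm, Matrix.mul_assoc, ← hB]
        rfl
      rw [h3]
      simp [partialTrace, Matrix.trace, Matrix.mul_apply, Fintype.sum_prod_type,
        Matrix.one_apply, apply_ite, ite_mul]
    rwa [h2] at h
  · intro X hX
    have := trace_mul_nonneg hX hW1
    rw [Matrix.mul_sub, Matrix.mul_one, trace_sub, sub_nonneg] at this
    exact this

variable {m : Type*} [Fintype m]

omit [Fintype m] in
theorem idTensor_traceFunctional_vecMulVec (W : Matrix r r ℂ) (ψ : m × r → ℂ) :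
    idTensor (traceFunctional W) (vecMulVec ψ (star ψ)) = unvec ψ * Wᵀ * (unvec ψ)ᴴ := by
  ext i j
  have : (Matrix.of fun a b => vecMulVec ψ (star ψ) (i, a) (j, b)) =
      vecMulVec (unvec ψ i) (star (unvec ψ j)) := rfl
  change traceFunctional W (Matrix.of fun a b => vecMulVec ψ (star ψ) (i, a) (j, b)) = _
  rw [this, traceFunctional_apply, vecMulVec_mul, trace_vecMulVec]
  simp only [dotProduct, vecMul, Matrix.mul_apply, transpose_apply, conjTranspose_apply,
    Finset.mul_sum, Finset.sum_mul, Pi.star_apply]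
  rw [Finset.sum_comm]
  exact Finset.sum_congr rfl fun a _ => Finset.sum_congr rfl fun b _ => by ring

theorem exists_extraction {G ι N : Type*} [Group G] [Fintype ι] [DecidableEq ι] [Fintype N]
    [DecidableEq N] (V : G →* Matrix.unitaryGroup ι ℂ) {τ : Matrix ((ι × ι) × N) ((ι × ι) × N) ℂ}
    (hτ : IsPurification (tauVW V) τ) {ρ : Matrix (ι × ι) (ι × ι) ℂ} (hρ : IsDensity ρ)
    (hS : IsSupportedOn ρ (invariantSpace V)) :
    ∃ T : Matrix N N ℂ →ₗ[ℂ] ℂ, IsCPTraceNonincreasing T ∧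
      ρ = (invariantDim V : ℂ) • idTensor T τ := by
  obtain ⟨⟨ψ, rfl⟩, hψ⟩ := hτ
  rw [partialTrace_vecMulVec] at hψ
  have hP : (invariantDim V : ℂ) • (unvec ψ * (unvec ψ)ᴴ) = invariantProjector V := by
    rw [hψ, invariantDim_smul_tauVW]
  have hPρ := invariantProjector_mul_of_range_le hS
  have hρP : ρ * invariantProjector V = ρ := by
    have := congrArg conjTranspose hPρ
    rwa [conjTranspose_mul, invariantProjector_conjTranspose, hρ.1.1.eq] at this
  -- The trace of `M` is `tr (ρ P) = 1`, hence `0 ≤ M ≤ 1`. The functional uses `Mᵀ` because an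
  -- effect on the purifying side acts through its transpose.
  let M : Matrix N N ℂ := (invariantDim V : ℂ) • ((unvec ψ)ᴴ * ρ * unvec ψ)
  have hM : M.PosSemidef := (hρ.1.conjTranspose_mul_mul_same _).smul (Nat.cast_nonneg _)
  have hMt : M.trace = 1 := by
    rw [← hρ.2, trace_smul, Matrix.mul_assoc, trace_mul_comm, Matrix.mul_assoc, ← trace_smul,
      ← Matrix.mul_smul, hP, hρP]
  have hM1 : (1 - M)ᵀ.PosSemidef := (posSemidef_one_sub hM (by simp [hMt])).transpose
  rw [transpose_sub, transpose_one] at hM1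
  refine ⟨traceFunctional Mᵀ, isCPTraceNonincreasing_traceFunctional hM.transpose hM1, ?_⟩
  rw [idTensor_traceFunctional_vecMulVec, transpose_transpose]
  calc ρ = invariantProjector V * ρ * invariantProjector V := by rw [hPρ, hρP]
    _ = _ := by
      rw [← hP]
      simp only [M, Matrix.mul_smul, Matrix.smul_mul, Matrix.mul_assoc]

end Extraction

/-! ### Common fixed points by norm minimization -/

section FixedPoint

/-- A nonempty closed convex set that is invariant under norm-preserving maps contains a common
fixed point: its element of least norm. -/
theorem exists_fixedPoint_of_closed_convex {E G : Type*} [NormedAddCommGroup E]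
    [InnerProductSpace ℝ E] [CompleteSpace E] {S : Set E} (hne : S.Nonempty) (hcl : IsClosed S)
    (hconv : Convex ℝ S) (φ : G → E → E) (hφ : ∀ g, ∀ x, ‖φ g x‖ = ‖x‖)
    (hS : ∀ g, ∀ x ∈ S, φ g x ∈ S) : ∃ x ∈ S, ∀ g, φ g x = x := by
  obtain ⟨v, hv, hmin⟩ := exists_norm_eq_iInf_of_complete_convex hne hcl.isComplete hconv 0
  have hle : ∀ w ∈ S, ‖v‖ ≤ ‖w‖ := by
    intro w hw
    have h : (⨅ w : S, ‖(0 : E) - w‖) ≤ ‖(0 : E) - w‖ :=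
      ciInf_le ⟨0, by rintro _ ⟨x, rfl⟩; exact norm_nonneg _⟩ (⟨w, hw⟩ : S)
    rw [← hmin] at h
    simpa using h
  refine ⟨v, hv, fun g => ?_⟩
  -- If `φ g v ≠ v`, the parallelogram law makes this midpoint strictly shorter than `v`.
  have hmid : (1 / 2 : ℝ) • φ g v + (1 / 2 : ℝ) • v ∈ S :=
    hconv (hS g v hv) hv (by norm_num) (by norm_num) (by norm_num)
  have h1 := hle _ hmid
  rw [← smul_add, norm_smul] at h1
  have h2 := parallelogram_law_with_norm ℝ (φ g v) v
  rw [hφ] at h2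
  have h3 : 2 * ‖v‖ ≤ ‖φ g v + v‖ := by
    norm_num at h1; linarith
  have h4 : ‖φ g v - v‖ = 0 := by
    have := norm_nonneg (φ g v - v)
    have := norm_nonneg v
    nlinarith
  exact sub_eq_zero.1 (norm_eq_zero.1 h4)

end FixedPoint

/-! ### Moving operators through the purifying system -/

section Factorization

variable {ι κ n o q R : Type*} [Fintype ι] [Fintype κ] [Fintype n] [Fintype o] [Fintype q]
  [Fintype R]

/-- Regroup the second tensor factor of the columns with the rows. -/
def regroup (A : Matrix ι (κ × n) ℂ) : Matrix (ι × κ) n ℂ :=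
  Matrix.of fun p t => A p.1 (p.2, t)

theorem sqNorm_regroup (A : Matrix ι (κ × n) ℂ) : sqNorm (regroup A) = sqNorm A := by
  simp [sqNorm_eq_sum, regroup, Fintype.sum_prod_type]

/-- The matrix with rows indexed by the second tensor factor, conjugated. -/
def corow (L : Matrix (o × R) q ℂ) : Matrix R (o × q) ℂ :=
  Matrix.of fun r p => star (L (p.1, r) p.2)

theorem sqNorm_corow (L : Matrix (o × R) q ℂ) : sqNorm (corow L) = sqNorm L := by
  simp only [sqNorm_eq_sum, corow, Fintype.sum_prod_type, of_apply, norm_star]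
  exact Finset.sum_comm

/-- The operator `(1 ⊗ Sᵀ) L`, regrouped. -/
def transfer (S : Matrix R (κ × n) ℂ) (L : Matrix (o × R) q ℂ) : Matrix (o × κ) (n × q) ℂ :=
  Matrix.of fun p t => ∑ r, S r (p.2, t.1) * L (p.1, r) t.2

/-- Both sides sum the same squared entries. The right side depends on `S` only through `S Sᴴ`, and
linearly, which is what permits averaging. -/
theorem sqNorm_transfer (S : Matrix R (κ × n) ℂ) (L : Matrix (o × R) q ℂ) :
    sqNorm (transfer S L) = ((corow L)ᴴ * S * ((corow L)ᴴ * S)ᴴ).trace.re := by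
  change _ = sqNorm ((corow L)ᴴ * S)
  simp only [sqNorm_eq_sum, Fintype.sum_prod_type, transfer, corow, Matrix.mul_apply, of_apply,
    conjTranspose_apply, star_star]
  refine Finset.sum_congr rfl fun p _ => ?_
  have : ∀ a t u, ∑ r, S r (a, t) * L (p, r) u = ∑ r, L (p, r) u * S r (a, t) :=
    fun a t u => Finset.sum_congr rfl fun r _ => mul_comm _ _
  simp only [this]
  calc _ = ∑ a, ∑ u, ∑ t, ‖∑ r, L (p, r) u * S r (a, t)‖ ^ 2 :=
        Finset.sum_congr rfl fun a _ => Finset.sum_comm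
    _ = _ := Finset.sum_comm

-- Operators on the purifying factor commute with `Δ ⊗ id`, so a factorization of the image of the
-- purification induces one for every operator reached from it.
omit [Fintype ι] [Fintype κ] [Fintype o] in
theorem tensorId_regroup_mul (Δ : Matrix ι ι ℂ →ₗ[ℂ] Matrix o o ℂ) (ψ : ι × R → ℂ)
    {L L' : Matrix (o × R) q ℂ} (hL : tensorId R Δ (vecMulVec ψ (star ψ)) = L * L'ᴴ)
    (S S' : Matrix R (κ × n) ℂ) :
    tensorId κ Δ (regroup (unvec ψ * S) * (regroup (unvec ψ * S'))ᴴ) =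
      transfer S L * (transfer S' L')ᴴ := by
  ext ⟨p, a⟩ ⟨p', b⟩
  have h1 : (Matrix.of fun i j => (regroup (unvec ψ * S) * (regroup (unvec ψ * S'))ᴴ)
      (i, a) (j, b)) = ∑ t, ∑ r, ∑ s, (S r (a, t) * star (S' s (b, t))) •
        (Matrix.of fun i j => vecMulVec ψ (star ψ) (i, r) (j, s)) := by
    ext i j
    simp only [of_apply, Matrix.mul_apply, regroup, unvec, conjTranspose_apply, Matrix.sum_apply,
      Matrix.smul_apply, vecMulVec_apply, star_sum, Finset.sum_mul_sum, smul_eq_mul, star_mul',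
      Pi.star_apply]
    exact Finset.sum_congr rfl fun t _ => Finset.sum_congr rfl fun r _ =>
      Finset.sum_congr rfl fun s _ => by ring
  have h2 : ∀ r s, Δ (Matrix.of fun i j => vecMulVec ψ (star ψ) (i, r) (j, s)) p p' =
      ∑ u, L (p, r) u * star (L' (p', s) u) := fun r s => by
    have := congrFun (congrFun hL (p, r)) (p', s)
    rw [Matrix.mul_apply] at this
    exact this
  change Δ (Matrix.of fun i j => (regroup (unvec ψ * S) * (regroup (unvec ψ * S'))ᴴ)
      (i, a) (j, b)) p p' = _
  rw [h1]
  simp only [map_sum, map_smul, Matrix.sum_apply, Matrix.smul_apply, h2, smul_eq_mul,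
    Matrix.mul_apply, Fintype.sum_prod_type, transfer, of_apply, conjTranspose_apply, star_sum,
    Finset.sum_mul_sum, star_mul']
  simp only [Finset.mul_sum]
  refine Finset.sum_congr rfl fun t _ => ?_
  calc _ = ∑ r, ∑ u, ∑ s, S r (a, t) * star (S' s (b, t)) *
          (L (p, r) u * star (L' (p', s) u)) :=
        Finset.sum_congr rfl fun r _ => Finset.sum_comm
    _ = ∑ u, ∑ r, ∑ s, S r (a, t) * star (S' s (b, t)) *
          (L (p, r) u * star (L' (p', s) u)) := Finset.sum_comm
    _ = _ := Finset.sum_congr rfl fun u _ => Finset.sum_congr rfl fun r _ =>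
      Finset.sum_congr rfl fun s _ => by ring

end Factorization

/-! ### Covariance and the trace norm -/

section Covariance

variable {G ι κ n o : Type*} [Group G] [Fintype ι] [DecidableEq ι] [Fintype κ] [DecidableEq κ]
  [Fintype n] [Fintype o] [DecidableEq o]

theorem conjTranspose_coe (V : G →* Matrix.unitaryGroup ι ℂ) (g : G) :
    (V g : Matrix ι ι ℂ)ᴴ = (V g⁻¹ : Matrix ι ι ℂ) := by
  rw [map_inv]; rfl

theorem coe_inv_mul_coe (V : G →* Matrix.unitaryGroup ι ℂ) (g : G) :
    (V g⁻¹ : Matrix ι ι ℂ) * (V g : Matrix ι ι ℂ) = 1 := by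
  rw [← UnitaryGroup.mul_val, ← map_mul]; simp

theorem traceNorm_tensorId_regroup_le (V : G →* Matrix.unitaryGroup ι ℂ)
    {Δ : Matrix ι ι ℂ →ₗ[ℂ] Matrix o o ℂ}
    (hΔ : ∀ g : G, ∃ K : Matrix o o ℂ →ₗ[ℂ] Matrix o o ℂ, IsCPTP K ∧
      Δ ∘ₗ conjAction V g = K ∘ₗ Δ)
    (g : G) (A B : Matrix ι (κ × n) ℂ) :
    traceNorm (tensorId κ Δ (regroup A * (regroup B)ᴴ)) ≤
      traceNorm (tensorId κ Δ (regroup ((V g : Matrix ι ι ℂ) * A) *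
        (regroup ((V g : Matrix ι ι ℂ) * B))ᴴ)) := by
  -- The inverse is used because the original operator is `g⁻¹` applied to the rotated one, so its
  -- image is a channel applied to the rotated image.
  obtain ⟨K, hK, hKΔ⟩ := hΔ g⁻¹
  set σ := regroup ((V g : Matrix ι ι ℂ) * A) * (regroup ((V g : Matrix ι ι ℂ) * B))ᴴ with hσ
  have h : tensorId κ Δ (regroup A * (regroup B)ᴴ) = tensorId κ K (tensorId κ Δ σ) := by
    ext ⟨p, a⟩ ⟨q, b⟩
    have hAB : (Matrix.of fun i j => (regroup A * (regroup B)ᴴ) (i, a) (j, b)) =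
        conjAction V g⁻¹ (Matrix.of fun i j => σ (i, a) (j, b)) := by
      let A' : Matrix ι n ℂ := Matrix.of fun i t => A i (a, t)
      let B' : Matrix ι n ℂ := Matrix.of fun i t => B i (b, t)
      have h1 : (Matrix.of fun i j => σ (i, a) (j, b)) =
        ((V g : Matrix ι ι ℂ) * A') * ((V g : Matrix ι ι ℂ) * B')ᴴ := rfl
      have h2 : (Matrix.of fun i j => (regroup A * (regroup B)ᴴ) (i, a) (j, b)) = A' * B'ᴴ := rfl
      rw [h1, h2, conjAction, LinearMap.mulLeftRight_apply, inv_inv, conjTranspose_mul,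
        conjTranspose_coe, Matrix.mul_assoc, Matrix.mul_assoc, Matrix.mul_assoc, Matrix.mul_assoc,
        coe_inv_mul_coe, Matrix.mul_one, ← Matrix.mul_assoc, coe_inv_mul_coe, Matrix.one_mul]
    change Δ (Matrix.of fun i j => (regroup A * (regroup B)ᴴ) (i, a) (j, b)) p q =
      K (Δ (Matrix.of fun i j => σ (i, a) (j, b))) p q
    rw [hAB]
    exact congrFun (congrFun (LinearMap.congr_fun hKΔ _) p) q
  rw [h]
  exact hK.traceNorm_tensorId_le _

end Covariance

/-! ### Twirling without Haar measure -/

section Twirling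

variable {G ι β : Type*} [Group G] [Fintype ι] [DecidableEq ι] [Fintype β]

/-- The members of a finite family of operators, stored in one Euclidean space. -/
def familyMat (b : β) : EuclideanSpace ℂ (β × ι × ι) →ₗ[ℝ] Matrix ι ι ℂ where
  toFun x := Matrix.of fun i j => x (b, i, j)
  map_add' _ _ := rfl
  map_smul' _ _ := rfl

/-- A finite family of operators as one vector of a Euclidean space. -/
def ofFamily (x : β → Matrix ι ι ℂ) : EuclideanSpace ℂ (β × ι × ι) :=
  WithLp.toLp 2 fun p => x p.1 p.2.1 p.2.2

omit [Fintype ι] [DecidableEq ι] [Fintype β] in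
theorem familyMat_ofFamily (x : β → Matrix ι ι ℂ) (b : β) : familyMat b (ofFamily x) = x b := rfl

omit [Fintype ι] [DecidableEq ι] [Fintype β] in
theorem ofFamily_familyMat (x : EuclideanSpace ℂ (β × ι × ι)) :
    ofFamily (fun b => familyMat b x) = x := rfl

omit [DecidableEq ι] in
theorem continuous_familyMat (b : β) :
    Continuous (familyMat b : EuclideanSpace ℂ (β × ι × ι) → Matrix ι ι ℂ) :=
  LinearMap.continuous_of_finiteDimensional _

omit [DecidableEq ι] in
theorem norm_sq_ofFamily (x : β → Matrix ι ι ℂ) : ‖ofFamily x‖ ^ 2 = ∑ b, sqNorm (x b) := by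
  simp [EuclideanSpace.norm_sq_eq, sqNorm_eq_sum, Fintype.sum_prod_type, ofFamily]

theorem sqNorm_conj (V : G →* Matrix.unitaryGroup ι ℂ) (g : G) (x : Matrix ι ι ℂ) :
    sqNorm ((V g : Matrix ι ι ℂ) * x * (V g : Matrix ι ι ℂ)ᴴ) = sqNorm x := by
  have h1 : ((V g : Matrix ι ι ℂ) * x * (V g : Matrix ι ι ℂ)ᴴ) *
      ((V g : Matrix ι ι ℂ) * x * (V g : Matrix ι ι ℂ)ᴴ)ᴴ =
      (V g : Matrix ι ι ℂ) * (x * xᴴ * (V g⁻¹ : Matrix ι ι ℂ)) := by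
    simp only [conjTranspose_mul, conjTranspose_conjTranspose, Matrix.mul_assoc]
    rw [conjTranspose_coe, ← Matrix.mul_assoc (V g⁻¹ : Matrix ι ι ℂ), coe_inv_mul_coe,
      Matrix.one_mul]
  rw [sqNorm, h1, trace_mul_comm, Matrix.mul_assoc, coe_inv_mul_coe, Matrix.mul_one, sqNorm]

omit [DecidableEq ι] in
theorem isClosed_posSemidef : IsClosed {A : Matrix ι ι ℂ | A.PosSemidef} := by
  simp only [posSemidef_iff_dotProduct_mulVec, Set.ofPred_and, Set.ofPred_forall]
  refine IsClosed.inter ?_ (isClosed_iInter fun v => ?_)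
  · exact isClosed_eq (by fun_prop) continuous_id
  · exact isClosed_le continuous_const (by fun_prop)

/-- If a real-linear functional of a family of positive operators is at least `c` along the whole
orbit of the family, then it is at least `c` at some family in the commutant. -/
theorem exists_commute_of_forall_orbit_le (V : G →* Matrix.unitaryGroup ι ℂ)
    (F : (β → Matrix ι ι ℂ) →ₗ[ℝ] ℝ) (c : ℝ) (x : β → Matrix ι ι ℂ)
    (hx : ∀ b, (x b).PosSemidef) (hxt : ∀ b, (x b).trace.re ≤ 1)
    (hF : ∀ g, c ≤ F fun b => (V g : Matrix ι ι ℂ) * x b * (V g : Matrix ι ι ℂ)ᴴ) :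
    ∃ y : β → Matrix ι ι ℂ, (∀ b, (y b).PosSemidef) ∧ (∀ b, (y b).trace.re ≤ 1) ∧
      (∀ b g, Commute (y b) (V g : Matrix ι ι ℂ)) ∧ c ≤ F y := by
  let mats : EuclideanSpace ℂ (β × ι × ι) →ₗ[ℝ] (β → Matrix ι ι ℂ) := LinearMap.pi familyMat
  let act : G → (β → Matrix ι ι ℂ) →ₗ[ℝ] (β → Matrix ι ι ℂ) := fun g =>
    LinearMap.pi fun b => (LinearMap.mulLeftRight ℝ
      ((V g : Matrix ι ι ℂ), (V g : Matrix ι ι ℂ)ᴴ)) ∘ₗ LinearMap.proj b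
  have hact : ∀ g y b, act g y b = (V g : Matrix ι ι ℂ) * y b * (V g : Matrix ι ι ℂ)ᴴ :=
    fun g y b => LinearMap.mulLeftRight_apply _ _ _
  -- Requiring the bound on the whole orbit makes `S` stable under `G`; linearity of `F` keeps it
  -- closed and convex. No topology on `G` is needed.
  let S : Set (EuclideanSpace ℂ (β × ι × ι)) :=
    {z | (∀ b, (familyMat b z).PosSemidef ∧ (familyMat b z).trace.re ≤ 1) ∧
      ∀ g, c ≤ F (act g (mats z))}
  have hne : S.Nonempty := by
    refine ⟨ofFamily x, fun b => ⟨hx b, hxt b⟩, fun g => ?_⟩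
    convert hF g using 2
    ext1 b
    exact hact g _ b
  have hcl : IsClosed S := by
    simp only [S, Set.ofPred_and, Set.ofPred_forall]
    refine IsClosed.inter (isClosed_iInter fun b => IsClosed.inter ?_ ?_)
      (isClosed_iInter fun g => ?_)
    · exact isClosed_posSemidef.preimage (continuous_familyMat b)
    · exact isClosed_le (Complex.continuous_re.comp (continuous_familyMat b).matrix_trace)
        continuous_const
    · exact isClosed_le continuous_const
        (LinearMap.continuous_of_finiteDimensional (F ∘ₗ act g ∘ₗ mats))
  have hconv : Convex ℝ S := by
    rintro z ⟨hz, hzF⟩ w ⟨hw, hwF⟩ s t hs ht hst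
    refine ⟨fun b => ⟨?_, ?_⟩, fun g => ?_⟩
    · rw [map_add, map_smul, map_smul]
      exact ((hz b).1.smul hs).add ((hw b).1.smul ht)
    · rw [map_add, map_smul, map_smul, trace_add, trace_smul, trace_smul, Complex.add_re,
        Complex.smul_re, Complex.smul_re, smul_eq_mul, smul_eq_mul]
      nlinarith [mul_le_mul_of_nonneg_left (hz b).2 hs, mul_le_mul_of_nonneg_left (hw b).2 ht]
    · simp only [map_add, map_smul, smul_eq_mul]
      have h1 := mul_le_mul_of_nonneg_left (hzF g) hs
      have h2 := mul_le_mul_of_nonneg_left (hwF g) ht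
      calc c = s * c + t * c := by rw [← add_mul, hst, one_mul]
        _ ≤ _ := add_le_add h1 h2
  obtain ⟨z, ⟨hz, hzF⟩, hfix⟩ := exists_fixedPoint_of_closed_convex hne hcl hconv
    (fun g z => ofFamily (act g (mats z)))
    (by
      intro g z
      rw [← sq_eq_sq₀ (norm_nonneg _) (norm_nonneg _), norm_sq_ofFamily]
      conv_rhs => rw [← ofFamily_familyMat z, norm_sq_ofFamily]
      refine Finset.sum_congr rfl fun b _ => ?_
      rw [hact, sqNorm_conj]
      rfl)
    (by
      rintro g z ⟨hz, hzF⟩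
      refine ⟨fun b => ?_, fun h => ?_⟩
      · rw [familyMat_ofFamily, hact]
        refine ⟨(hz b).1.mul_mul_conjTranspose_same _, ?_⟩
        rw [Matrix.mul_assoc, trace_mul_comm, Matrix.mul_assoc, conjTranspose_coe, coe_inv_mul_coe,
          Matrix.mul_one]
        exact (hz b).2
      · have h1 : act h (mats (ofFamily (act g (mats z)))) = act (h * g) (mats z) := by
          ext1 b
          have h2 : mats (ofFamily (act g (mats z))) = act g (mats z) := rfl
          rw [h2, hact, hact, hact, map_mul, UnitaryGroup.mul_val, conjTranspose_mul]
          simp only [Matrix.mul_assoc]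
        rw [h1]
        exact hzF _)
  have hy : ∀ g b, (V g : Matrix ι ι ℂ) * familyMat b z * (V g : Matrix ι ι ℂ)ᴴ =
      familyMat b z := by
    intro g b
    have := congrArg (familyMat b) (hfix g)
    rwa [familyMat_ofFamily, hact] at this
  refine ⟨fun b => familyMat b z, fun b => (hz b).1, fun b => (hz b).2, fun b g => ?_, ?_⟩
  · have h1 := congrArg (· * (V g : Matrix ι ι ℂ)) (hy g b)
    simp only [Matrix.mul_assoc] at h1
    rw [conjTranspose_coe, coe_inv_mul_coe, Matrix.mul_one] at h1
    exact h1.symm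
  · have h1 : act 1 (mats z) = fun b => familyMat b z := by
      ext1 b
      rw [hact]
      exact hy 1 b
    rw [← h1]
    exact hzF 1

end Twirling

/-! ### The diamond norm bound -/

section DiamondNormBound

variable {G ι o R : Type*} [Group G] [Fintype ι] [DecidableEq ι] [Fintype o] [DecidableEq o]
  [Fintype R] [DecidableEq R]

omit [DecidableEq R] in
/-- If `D T T†` is invertible, then `T` has a right inverse which dilates `D T T†` to at most
`D`. -/
theorem exists_rightInverse_of_isUnit {T : Matrix ι R ℂ} {D : ℕ}
    (hT : IsUnit ((D : ℂ) • (T * Tᴴ))) :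
    ∃ S : Matrix R ι ℂ, T * S = 1 ∧ ∀ {q : Type*} [Fintype q] (B : Matrix R q ℂ),
      (Bᴴ * S * ((D : ℂ) • (T * Tᴴ)) * (Bᴴ * S)ᴴ).trace.re ≤ D * sqNorm B := by
  set Q := (D : ℂ) • (T * Tᴴ) with hQ
  have hQQ : Q * Q⁻¹ = 1 := Matrix.mul_nonsing_inv _ ((Matrix.isUnit_iff_isUnit_det _).1 hT)
  have hQQ' : Q⁻¹ * Q = 1 := Matrix.nonsing_inv_mul _ ((Matrix.isUnit_iff_isUnit_det _).1 hT)
  have hQh : Qᴴ = Q := by simp [hQ]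
  have hQih : (Q⁻¹)ᴴ = Q⁻¹ := by rw [conjTranspose_nonsing_inv, hQh]
  -- This is the Moore–Penrose right inverse `Tᴴ (T Tᴴ)⁻¹`, chosen so that `S T` is an orthogonal
  -- projection and `S Q Sᴴ = D S T`.
  set S : Matrix R ι ℂ := (D : ℂ) • (Tᴴ * Q⁻¹) with hS
  have hTS : T * S = 1 := by
    rw [hS, Matrix.mul_smul, ← Matrix.mul_assoc, ← Matrix.smul_mul, ← hQ, hQQ]
  have hSTh : (S * T)ᴴ = S * T := by
    simp [hS, hQih, Matrix.mul_assoc]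
  have hST : (S * T) * (S * T) = S * T := by
    rw [Matrix.mul_assoc, ← Matrix.mul_assoc T, hTS, Matrix.one_mul]
  refine ⟨S, hTS, fun {q} _ B => ?_⟩
  have h1 : Bᴴ * S * Q * (Bᴴ * S)ᴴ = (D : ℂ) • (Bᴴ * (S * T) * B) := by
    have h2 : S * Q * Sᴴ = (D : ℂ) • (S * T) := by
      have h3 : S * Q = (D : ℂ) • Tᴴ := by
        rw [hS, Matrix.smul_mul, Matrix.mul_assoc, hQQ', Matrix.mul_one]
      rw [h3, Matrix.smul_mul, ← conjTranspose_mul, hSTh]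
    calc _ = Bᴴ * (S * Q * Sᴴ) * B := by
          simp only [conjTranspose_mul, conjTranspose_conjTranspose, Matrix.mul_assoc]
      _ = _ := by rw [h2, Matrix.mul_smul, Matrix.smul_mul]
  rw [h1, trace_smul, smul_eq_mul, ← Complex.ofReal_natCast, Complex.re_ofReal_mul]
  exact mul_le_mul_of_nonneg_left (re_trace_conjTranspose_mul_mul_le hSTh hST B)
    (Nat.cast_nonneg D)

theorem traceNorm_tensorId_le_of_covariant {κ : Type*} [Fintype κ] [DecidableEq κ]
    (V : G →* Matrix.unitaryGroup ι ℂ) {Δ : Matrix ι ι ℂ →ₗ[ℂ] Matrix o o ℂ}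
    (hΔ : ∀ g : G, ∃ K : Matrix o o ℂ →ₗ[ℂ] Matrix o o ℂ, IsCPTP K ∧
      Δ ∘ₗ conjAction V g = K ∘ₗ Δ)
    {τ : Matrix (ι × R) (ι × R) ℂ} (hτ : IsPurification (tauV V) τ)
    {σ : Matrix (ι × κ) (ι × κ) ℂ} (hσ : traceNorm σ ≤ 1) :
    traceNorm (tensorId κ Δ σ) ≤ invariantDim V * traceNorm (tensorId R Δ τ) := by
  obtain ⟨⟨ψ, rfl⟩, hψ⟩ := hτ
  rw [partialTrace_vecMulVec] at hψ
  set T := unvec ψ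
  have hQ : (invariantDim V : ℂ) • (T * Tᴴ) = partialTrace (invariantProjector V) := by
    rw [hψ, tauV, ← partialTrace_smul, invariantDim_smul_tauVW]
  obtain ⟨P, hTP, hP⟩ := exists_rightInverse_of_isUnit (T := T) (D := invariantDim V)
    (hQ ▸ isUnit_partialTrace_invariantProjector V)
  rw [hQ] at hP
  obtain ⟨L, L', hL, hLn, hLn'⟩ :=
    exists_traceNorm_factorization (tensorId R Δ (vecMulVec ψ (star ψ)))
  obtain ⟨M, M', hM, hMn, hMn'⟩ := exists_traceNorm_factorization σ
  -- With `κ` moved to the columns, `A b * (A b)ᴴ` is the reduced operator on `ι`, and its trace is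
  -- the squared norm of the factor of `σ`.
  let ungroup : Matrix (ι × κ) (ι × κ) ℂ → Matrix ι (κ × (ι × κ)) ℂ :=
    fun M => Matrix.of fun i t => M (i, t.1) t.2
  have hreg : ∀ M, regroup (ungroup M) = M := fun _ => rfl
  let A : Bool → Matrix ι (κ × (ι × κ)) ℂ := fun b => ungroup (bif b then M else M')
  let B : Bool → Matrix R (o × (o × R)) ℂ := fun b => corow (bif b then L else L')
  have hA : ∀ b, sqNorm (A b) ≤ 1 := by
    intro b
    rw [← sqNorm_regroup, hreg]
    cases b
    · exact hMn'.trans_le hσ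
    · exact hMn.trans_le hσ
  have hB : ∀ b, sqNorm (B b) = traceNorm (tensorId R Δ (vecMulVec ψ (star ψ))) := by
    intro b
    rw [sqNorm_corow]
    cases b
    · exact hLn'
    · exact hLn
  let f : Bool → Matrix ι ι ℂ →ₗ[ℝ] ℝ := fun b =>
    { toFun := fun x => ((B b)ᴴ * P * x * ((B b)ᴴ * P)ᴴ).trace.re
      map_add' := fun x y => by
        rw [Matrix.mul_add, Matrix.add_mul, trace_add, Complex.add_re]
      map_smul' := fun c x => by
        rw [Matrix.mul_smul, Matrix.smul_mul, trace_smul, Complex.smul_re, RingHom.id_apply] }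
  have hf : ∀ b x, f b x = ((B b)ᴴ * P * x * ((B b)ᴴ * P)ᴴ).trace.re := fun _ _ => rfl
  let F : (Bool → Matrix ι ι ℂ) →ₗ[ℝ] ℝ := (1 / 2 : ℝ) • ∑ b, f b ∘ₗ LinearMap.proj b
  have hF : ∀ x, F x = (f true (x true) + f false (x false)) / 2 := by
    intro x
    simp [F]
    ring
  obtain ⟨y, hy, hyt, hyc, hyF⟩ := exists_commute_of_forall_orbit_le V F
    (traceNorm (tensorId κ Δ σ)) (fun b => A b * (A b)ᴴ)
    (fun b => posSemidef_self_mul_conjTranspose _) hA (by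
      intro g
      have h1 := traceNorm_tensorId_regroup_le V hΔ g (A true) (A false)
      have h2 : regroup (A true) * (regroup (A false))ᴴ = σ := hM.symm
      -- The right inverse expresses each rotated factor as `T` times an operator on the purifying
      -- side.
      have h3 : ∀ b, (V g : Matrix ι ι ℂ) * A b = T * (P * ((V g : Matrix ι ι ℂ) * A b)) := by
        intro b
        rw [← Matrix.mul_assoc T, hTP, Matrix.one_mul]
      rw [h2, h3, h3 false, tensorId_regroup_mul Δ ψ hL] at h1
      refine (h1.trans (traceNorm_mul_conjTranspose_le _ _)).trans_eq ?_
      have h4 : ∀ (b : Bool), sqNorm (transfer (P * ((V g : Matrix ι ι ℂ) * A b))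
          (bif b then L else L')) = f b ((V g : Matrix ι ι ℂ) * (A b * (A b)ᴴ) *
            (V g : Matrix ι ι ℂ)ᴴ) := by
        intro b
        rw [sqNorm_transfer, hf]
        simp only [B, conjTranspose_mul, Matrix.mul_assoc]
      rw [hF, ← h4, ← h4]
      rfl)
  have hfy : ∀ b, f b (y b) ≤
      invariantDim V * traceNorm (tensorId R Δ (vecMulVec ψ (star ψ))) := by
    intro b
    -- Domination by `D τ_V` applies only to the commutant element `y b`, which is why the original
    -- reduced operators had to be replaced.
    have h1 := posSemidef_partialTrace_invariantProjector_sub (hy b) (hyt b) (hyc b)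
    have h2 := (Complex.le_def.1 (h1.mul_mul_conjTranspose_same ((B b)ᴴ * P)).trace_nonneg).1
    rw [Matrix.mul_sub, Matrix.sub_mul, trace_sub, Complex.sub_re, Complex.zero_re, sub_nonneg]
      at h2
    rw [hf, ← hB b]
    exact h2.trans (hP (B b))
  rw [hF] at hyF
  linarith [hfy true, hfy false]

theorem diamondNorm_le_of_covariant (V : G →* Matrix.unitaryGroup ι ℂ)
    {Δ : Matrix ι ι ℂ →ₗ[ℂ] Matrix o o ℂ}
    (hΔ : ∀ g : G, ∃ K : Matrix o o ℂ →ₗ[ℂ] Matrix o o ℂ, IsCPTP K ∧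
      Δ ∘ₗ conjAction V g = K ∘ₗ Δ)
    {τ : Matrix (ι × R) (ι × R) ℂ} (hτ : IsPurification (tauV V) τ) :
    diamondNorm Δ ≤ (invariantDim V : ENNReal) *
      ENNReal.ofReal (traceNorm (tensorId R Δ τ)) := by
  refine iSup_le fun k => iSup_le fun σ => iSup_le fun hσ => ?_
  rw [← ENNReal.ofReal_natCast, ← ENNReal.ofReal_mul (Nat.cast_nonneg _)]
  exact ENNReal.ofReal_le_ofReal (traceNorm_tensorId_le_of_covariant V hΔ hτ hσ)

end DiamondNormBound

end PostSelection

theorem mainTheorem3 {G ι : Type*} [Group G] [Fintype ι] [DecidableEq ι]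
    (V : G →* Matrix.unitaryGroup ι ℂ) :
    -- extraction of states on the invariant space by post-selection on the purifying system
    (∀ (N : Type*) [Fintype N] [DecidableEq N]
        (τ : Matrix ((ι × ι) × N) ((ι × ι) × N) ℂ),
        PostSelection.IsPurification (PostSelection.tauVW V) τ →
      ∀ ρ : Matrix (ι × ι) (ι × ι) ℂ, PostSelection.IsDensity ρ →
        PostSelection.IsSupportedOn ρ (PostSelection.invariantSpace V) →
      ∃ T : Matrix N N ℂ →ₗ[ℂ] ℂ, PostSelection.IsCPTraceNonincreasing T ∧
        ρ = (PostSelection.invariantDim V : ℂ) • PostSelection.idTensor T τ) ∧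
    -- the post-selection bound for covariant maps
    (∀ (o : Type*) [Fintype o] [DecidableEq o] (Δ : Matrix ι ι ℂ →ₗ[ℂ] Matrix o o ℂ),
        (∀ g : G, ∃ K : Matrix o o ℂ →ₗ[ℂ] Matrix o o ℂ, PostSelection.IsCPTP K ∧
          Δ ∘ₗ PostSelection.conjAction V g = K ∘ₗ Δ) →
      ∀ (R : Type*) [Fintype R] [DecidableEq R] (τ : Matrix (ι × R) (ι × R) ℂ),
        PostSelection.IsPurification (PostSelection.tauV V) τ →
        PostSelection.diamondNorm Δ ≤ (PostSelection.invariantDim V : ENNReal) *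
          ENNReal.ofReal (PostSelection.traceNorm (PostSelection.tensorId R Δ τ))) :=
  ⟨fun _ _ _ _ hτ _ hρ hS => PostSelection.exists_extraction V hτ hρ hS,
    fun _ _ _ _ hΔ _ _ _ _ hτ => PostSelection.diamondNorm_le_of_covariant V hΔ hτ⟩
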